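/- Let $M$ be a metric space with more than one point and with a distinguished point $0\in M$. Let $\operatorname{Lip}_0(M)$ be the space of all Lipschitz functions $f\colon M\to\mathbb R$ with $f(0)=0$, normed by the Lipschitz constant $$\|f\|=\sup\Bigl\{\tfrac{|f(p)-f(q)|}{d(p,q)}\colon p,q\in M,\ p\neq q\Bigr\},$$ and let the Lipschitz-free space be $$\mathcal F(M)=\overline{\operatorname{span}}\{\delta_p\colon p\in M\}\subset \operatorname{Lip}_0(M)^*,\qquad \delta_p(f)=f(p),$$ with the dual norm. For $s\in(0,1]$, a real Banach space $X$ with unit sphere $S_X$ is called $s$-almost square if, for every $\varepsilon>0$ and every finite subset $\{x_1,\dots,x_n\}$ of $S_X$, there exists $y\in S_X$ such that $\|x_i+sy\|\le 1+\varepsilon$ and $\|x_i-sy\|\le 1+\varepsilon$ for every $i\in\{1,\dots,n\}$; it is called almost square if it satisfies this with $s=1$. Then $\mathcal F(M)$ is not almost square. In fact, $\mathcal F(M)$ is not $s$-almost square for any $0<s\le 1$. -/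

import Mathlib

/-- The real vector space of Lipschitz functions on `M` vanishing at the base point `x₀`. -/
def lipZeroSubmodule (M : Type*) [MetricSpace M] (x₀ : M) : Submodule ℝ (M → ℝ) where
  carrier := {f | f x₀ = 0 ∧ ∃ K : NNReal, LipschitzWith K f}
  zero_mem' := ⟨rfl, 0, LipschitzWith.const 0⟩
  add_mem' := by
    rintro f g ⟨hf, K, hK⟩ ⟨hg, L, hL⟩
    exact ⟨by simp [hf, hg], K + L, hK.add hL⟩
  smul_mem' := by
    rintro c f ⟨hf, K, hK⟩
    refine ⟨by simp [hf], ‖c‖₊ * K, LipschitzWith.of_dist_le_mul fun p q => ?_⟩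
    have h := hK.dist_le_mul p q
    have h2 := mul_le_mul_of_nonneg_left h (norm_nonneg c)
    simpa [Real.dist_eq, ← mul_sub, abs_mul, mul_assoc] using h2

/-- `Lip₀(M)` with base point `x₀`. This is a type of its own, so that it carries the
Lipschitz-constant norm and not the topology of pointwise convergence. -/
def LipZero (M : Type*) [MetricSpace M] (x₀ : M) : Type _ := ↥(lipZeroSubmodule M x₀)

namespace LipZero

variable {M : Type*} [MetricSpace M] {x₀ : M}

noncomputable instance : AddCommGroup (LipZero M x₀) :=
  inferInstanceAs (AddCommGroup ↥(lipZeroSubmodule M x₀))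

noncomputable instance : Module ℝ (LipZero M x₀) :=
  inferInstanceAs (Module ℝ ↥(lipZeroSubmodule M x₀))

instance : CoeFun (LipZero M x₀) (fun _ => M → ℝ) := ⟨fun f => f.1⟩

@[ext] theorem ext {f g : LipZero M x₀} (h : ∀ p, f p = g p) : f = g :=
  Subtype.ext (funext h)

@[simp] theorem zero_apply (p : M) : (0 : LipZero M x₀) p = 0 := rfl

@[simp] theorem add_apply (f g : LipZero M x₀) (p : M) : (f + g) p = f p + g p := rfl

@[simp] theorem smul_apply (c : ℝ) (f : LipZero M x₀) (p : M) : (c • f) p = c * f p := rfl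

@[simp] theorem apply_base (f : LipZero M x₀) : f x₀ = 0 := f.2.1

/-- The difference quotients `|f p - f q| / d(p, q)` over pairs of distinct points. -/
def slopes (f : LipZero M x₀) : Set ℝ :=
  {r | ∃ p q : M, p ≠ q ∧ r = |f p - f q| / dist p q}

/-- The norm of `f` is its best Lipschitz constant. -/
noncomputable instance : Norm (LipZero M x₀) := ⟨fun f => sSup f.slopes⟩

theorem norm_def (f : LipZero M x₀) : ‖f‖ = sSup f.slopes := rfl

theorem bddAbove_slopes (f : LipZero M x₀) : BddAbove f.slopes := by
  obtain ⟨K, hK⟩ := f.2.2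
  refine ⟨K, ?_⟩
  rintro r ⟨p, q, hpq, rfl⟩
  rw [div_le_iff₀ (dist_pos.2 hpq)]
  simpa [Real.dist_eq] using hK.dist_le_mul p q

theorem norm_nonneg' (f : LipZero M x₀) : 0 ≤ ‖f‖ := by
  refine Real.sSup_nonneg ?_
  rintro r ⟨p, q, -, rfl⟩
  positivity

theorem abs_sub_le (f : LipZero M x₀) (p q : M) : |f p - f q| ≤ ‖f‖ * dist p q := by
  by_cases h : p = q
  · simp [h]
  · rw [← div_le_iff₀ (dist_pos.2 h)]
    exact le_csSup f.bddAbove_slopes ⟨p, q, h, rfl⟩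

theorem norm_le_of_abs_sub_le (f : LipZero M x₀) {C : ℝ} (hC : 0 ≤ C)
    (h : ∀ p q : M, |f p - f q| ≤ C * dist p q) : ‖f‖ ≤ C := by
  refine Real.sSup_le ?_ hC
  rintro r ⟨p, q, hpq, rfl⟩
  rw [div_le_iff₀ (dist_pos.2 hpq)]
  exact h p q

theorem norm_smul_le' (c : ℝ) (f : LipZero M x₀) : ‖c • f‖ ≤ |c| * ‖f‖ := by
  refine norm_le_of_abs_sub_le _ (mul_nonneg (abs_nonneg c) f.norm_nonneg') fun p q => ?_
  rw [smul_apply, smul_apply, ← mul_sub, abs_mul, mul_assoc]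
  exact mul_le_mul_of_nonneg_left (f.abs_sub_le p q) (abs_nonneg c)

theorem normedSpaceCore (M : Type*) [MetricSpace M] (x₀ : M) :
    NormedSpace.Core ℝ (LipZero M x₀) where
  norm_nonneg := norm_nonneg'
  norm_smul c f := by
    rw [Real.norm_eq_abs]
    refine le_antisymm (norm_smul_le' c f) ?_
    by_cases hc : c = 0
    · simpa [hc] using norm_nonneg' ((0 : ℝ) • f)
    · have h := norm_smul_le' c⁻¹ (c • f)
      rw [smul_smul, inv_mul_cancel₀ hc, one_smul, abs_inv] at h
      rwa [← le_inv_mul_iff₀ (abs_pos.2 hc)]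
  norm_triangle f g := by
    refine norm_le_of_abs_sub_le _ (add_nonneg f.norm_nonneg' g.norm_nonneg') fun p q => ?_
    have h := abs_add_le (f p - f q) (g p - g q)
    have hf := f.abs_sub_le p q
    have hg := g.abs_sub_le p q
    have e : (f + g) p - (f + g) q = (f p - f q) + (g p - g q) := by
      rw [add_apply, add_apply]; ring
    rw [e]
    linarith
  norm_eq_zero_iff f := by
    constructor
    · intro h
      ext p
      have := f.abs_sub_le p x₀
      rw [h, zero_mul, apply_base, sub_zero] at this
      simpa using abs_nonpos_iff.1 this
    · rintro rfl
      refine le_antisymm (norm_le_of_abs_sub_le _ le_rfl fun p q => ?_) (norm_nonneg' _)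
      simp

noncomputable instance : NormedAddCommGroup (LipZero M x₀) :=
  NormedAddCommGroup.ofCore (normedSpaceCore M x₀)

noncomputable instance : NormedSpace ℝ (LipZero M x₀) :=
  NormedSpace.ofCore (normedSpaceCore M x₀)

/-- The evaluation functional `δ_p : f ↦ f p` as an element of the dual of `Lip₀(M)`. -/
noncomputable def delta (x₀ p : M) : StrongDual ℝ (LipZero M x₀) :=
  LinearMap.mkContinuous
    { toFun := fun f => f p
      map_add' := fun _ _ => rfl
      map_smul' := fun _ _ => rfl }
    (dist p x₀) (fun f => by
      have h := f.abs_sub_le p x₀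
      rw [apply_base, sub_zero, mul_comm] at h
      exact h)

@[simp] theorem delta_apply (p : M) (f : LipZero M x₀) : delta x₀ p f = f p := rfl

end LipZero

/-- The Lipschitz-free space `𝓕(M)`: the norm closure of the span of the evaluations
in the dual of `Lip₀(M)`, with the dual norm. -/
noncomputable def lipschitzFree (M : Type*) [MetricSpace M] (x₀ : M) :
    Submodule ℝ (StrongDual ℝ (LipZero M x₀)) :=
  (Submodule.span ℝ (Set.range (LipZero.delta x₀))).topologicalClosure

/-- Almost square (ASQ) normed spaces. -/
def IsAlmostSquare (X : Type*) [NormedAddCommGroup X] [NormedSpace ℝ X] : Prop :=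
  ∀ ε : ℝ, 0 < ε → ∀ A : Finset X, (∀ x ∈ A, ‖x‖ = 1) →
    ∃ y : X, ‖y‖ = 1 ∧ ∀ x ∈ A, ‖x + y‖ ≤ 1 + ε ∧ ‖x - y‖ ≤ 1 + ε

/-- `s`-almost square (`s`-ASQ) normed spaces. -/
def IsSAlmostSquare (s : ℝ) (X : Type*) [NormedAddCommGroup X] [NormedSpace ℝ X] : Prop :=
  ∀ ε : ℝ, 0 < ε → ∀ A : Finset X, (∀ x ∈ A, ‖x‖ = 1) →
    ∃ y : X, ‖y‖ = 1 ∧ ∀ x ∈ A, ‖x + s • y‖ ≤ 1 + ε ∧ ‖x - s • y‖ ≤ 1 + ε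

/-!
A molecule `m_{pq} = (δ_p - δ_q) / d(p, q)` has norm one, and if `‖m_{pq} ± s y‖ ≤ 1 + ε`, then `y`
is nearly zero on every `1`-Lipschitz function `f` that nearly norms `m_{pq}`
(`abs_apply_le_of_norm_molecule_add_smul_le`). It therefore suffices to find finitely many
molecules such that a functional which is small on the functions nearly norming them is small
on a whole ball of `Lip₀(M)` (`exists_finite_smallOnNorming`); such a `y` cannot have norm one.

The tool is the bump `b(z) = max (ρ - d(z, p)) 0`. If `ρ` is at most, but nearly, `d(p, q)`, then `b`
nearly norms `m_{pq}`. So does `b ⊔ h` for every `1`-Lipschitz `h ≥ 0` that vanishes at `q` and on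
the ball of radius `ρ` about `p`; since `b ⊔ h = b + h`, smallness of `y` passes to `h`
(`SmallOnNorming.apply_of_nonneg`).

* If `p` is isolated, take `ρ` to be its distance to the other points and `q` a nearly closest point.
  The ball about `p` is `{p}`, and every Lipschitz function is, up to a constant, a multiple of `b`
  plus a function vanishing at `p` and `q`. One molecule suffices.
* If no point is isolated, take `p ≠ p'` together with `q` and `q'` so close to them that the balls
  involved are disjoint. A `1 / 4`-Lipschitz function `g ≥ 0` with `g p = 0` is the
  sum of `g ⊓ (max (2 ρ - d(·, p)) 0 / 2)`, where `ρ = d(p, q)`, which vanishes near `p'`, and of a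
  remainder, which vanishes near `p`. Two molecules suffice.
-/

namespace LipZero

variable {M : Type*} [MetricSpace M] {x₀ : M}

/-! ### Lipschitz functions modulo constants -/

/-- The element `f - f x₀` of `Lip₀(M)` defined by an arbitrary Lipschitz function `f`. -/
def ofLipschitz (x₀ : M) (f : M → ℝ) {K : NNReal} (hf : LipschitzWith K f) : LipZero M x₀ :=
  ⟨fun z => f z - f x₀, sub_self _, K, LipschitzWith.of_dist_le_mul fun p q => by
    simpa [Real.dist_eq] using hf.dist_le_mul p q⟩

@[simp] theorem ofLipschitz_apply (f : M → ℝ) {K : NNReal} (hf : LipschitzWith K f) (z : M) :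
    ofLipschitz x₀ f hf z = f z - f x₀ := rfl

theorem norm_ofLipschitz_le (f : M → ℝ) {K : NNReal} (hf : LipschitzWith K f) :
    ‖ofLipschitz x₀ f hf‖ ≤ K :=
  norm_le_of_abs_sub_le _ K.2 fun p q => by
    simpa [Real.dist_eq] using hf.dist_le_mul p q

/-- The bump of height `ρ` and slope one centred at `p`. -/
noncomputable def bump (p : M) (ρ : ℝ) (z : M) : ℝ := max (ρ - dist z p) 0

theorem lipschitzWith_bump (p : M) (ρ : ℝ) : LipschitzWith 1 (bump p ρ) := by
  refine LipschitzWith.max_const (LipschitzWith.of_dist_le_mul fun z w => ?_) 0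
  rw [Real.dist_eq, sub_sub_sub_cancel_left, NNReal.coe_one, one_mul, dist_comm z w]
  exact abs_dist_sub_le w z p

theorem bump_self (p : M) {ρ : ℝ} (hρ : 0 ≤ ρ) : bump p ρ p = ρ := by
  simp [bump, hρ]

theorem bump_eq_zero {p z : M} {ρ : ℝ} (h : ρ ≤ dist z p) : bump p ρ z = 0 :=
  max_eq_right (by linarith)

theorem bump_nonneg (p : M) (ρ : ℝ) (z : M) : 0 ≤ bump p ρ z := le_max_right _ _

/-! ### Molecules -/

/-- The molecule `(δ_p - δ_q) / d(p, q)`. -/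
noncomputable def molecule (x₀ p q : M) : StrongDual ℝ (LipZero M x₀) :=
  (dist p q)⁻¹ • (delta x₀ p - delta x₀ q)

theorem molecule_apply (p q : M) (f : LipZero M x₀) :
    molecule x₀ p q f = (dist p q)⁻¹ * (f p - f q) := rfl

theorem molecule_mem_lipschitzFree (p q : M) : molecule x₀ p q ∈ lipschitzFree M x₀ :=
  Submodule.le_topologicalClosure _ <| Submodule.smul_mem _ _ <| Submodule.sub_mem _
    (Submodule.subset_span ⟨p, rfl⟩) (Submodule.subset_span ⟨q, rfl⟩)

theorem norm_molecule {p q : M} (hpq : p ≠ q) : ‖molecule x₀ p q‖ = 1 := by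
  have hd := dist_pos.2 hpq
  refine le_antisymm (ContinuousLinearMap.opNorm_le_bound _ zero_le_one fun f => ?_) ?_
  · rw [molecule_apply, Real.norm_eq_abs, abs_mul, abs_inv, abs_of_pos hd, one_mul,
      inv_mul_le_iff₀ hd, mul_comm]
    exact f.abs_sub_le p q
  · -- The bump of height `d(p, q)` about `p` norms the molecule.
    have h := (molecule x₀ p q).le_opNorm (ofLipschitz x₀ _ (lipschitzWith_bump p (dist p q)))
    have h1 := norm_ofLipschitz_le (x₀ := x₀) _ (lipschitzWith_bump p (dist p q))
    rw [molecule_apply, ofLipschitz_apply, ofLipschitz_apply, bump_self p hd.le,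
      bump_eq_zero (dist_comm p q).le, sub_sub_sub_cancel_right, sub_zero,
      inv_mul_cancel₀ hd.ne', norm_one] at h
    exact h.trans (mul_le_of_le_one_right (norm_nonneg _) h1)

/-- The functional `y` is at most `c` in absolute value on all `1`-Lipschitz functions that norm
the molecule of `p` and `q` up to `η`. -/
def SmallOnNorming (y : StrongDual ℝ (LipZero M x₀)) (p q : M) (η c : ℝ) : Prop :=
  ∀ (f : M → ℝ) (hf : LipschitzWith 1 f), (1 - η) * dist p q ≤ f p - f q →
    |y (ofLipschitz x₀ f hf)| ≤ c

theorem abs_apply_le_of_norm_molecule_add_smul_le {y : StrongDual ℝ (LipZero M x₀)} {p q : M}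
    (hpq : p ≠ q) {s ε η : ℝ} (hs : 0 < s)
    (h₁ : ‖molecule x₀ p q + s • y‖ ≤ 1 + ε) (h₂ : ‖molecule x₀ p q - s • y‖ ≤ 1 + ε) :
    SmallOnNorming y p q η ((ε + η) / s) := by
  intro f hf hfpq
  have hd := dist_pos.2 hpq
  set F := ofLipschitz x₀ f hf with hF
  have hF1 : ‖F‖ ≤ 1 := norm_ofLipschitz_le f hf
  have hm : 1 - η ≤ molecule x₀ p q F := by
    rw [molecule_apply, hF, ofLipschitz_apply, ofLipschitz_apply, sub_sub_sub_cancel_right,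
      le_inv_mul_iff₀ hd, mul_comm]
    exact hfpq
  have k₁ : molecule x₀ p q F + s * y F ≤ 1 + ε :=
    (le_abs_self _).trans (((molecule x₀ p q + s • y).le_of_opNorm_le_of_le h₁ hF1).trans_eq
      (mul_one _))
  have k₂ : molecule x₀ p q F - s * y F ≤ 1 + ε :=
    (le_abs_self _).trans (((molecule x₀ p q - s • y).le_of_opNorm_le_of_le h₂ hF1).trans_eq
      (mul_one _))
  have habs : |s * y F| = s * |y F| := by rw [abs_mul, abs_of_pos hs]
  rw [le_div_iff₀ hs, mul_comm, ← habs, abs_le]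
  constructor <;> linarith

/-! ### Smallness away from a bump -/

namespace SmallOnNorming

variable {y : StrongDual ℝ (LipZero M x₀)} {p q : M} {η c ρ : ℝ}

theorem apply_bump (hy : SmallOnNorming y p q η c) (hρ : 0 ≤ ρ)
    (hρ₁ : (1 - η) * dist p q ≤ ρ) (hρ₂ : ρ ≤ dist p q) :
    |y (ofLipschitz x₀ _ (lipschitzWith_bump p ρ))| ≤ c := by
  refine hy _ _ ?_
  rwa [bump_self p hρ, bump_eq_zero (hρ₂.trans_eq (dist_comm p q)), sub_zero]

/-- Smallness passes to the nonnegative functions `h` that vanish at `q` and near `p`: the functions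
`bump p ρ` and `bump p ρ ⊔ h = bump p ρ + h` both nearly norm the molecule. -/
theorem apply_of_nonneg (hy : SmallOnNorming y p q η c) (hρ : 0 < ρ)
    (hρ₁ : (1 - η) * dist p q ≤ ρ) (hρ₂ : ρ ≤ dist p q) {h : M → ℝ} (hh : LipschitzWith 1 h)
    (h0 : ∀ z, 0 ≤ h z) (hball : ∀ z, dist z p < ρ → h z = 0) (hq : h q = 0) :
    |y (ofLipschitz x₀ h hh)| ≤ 2 * c := by
  have hb := hy.apply_bump hρ.le hρ₁ hρ₂
  have hsup : LipschitzWith 1 (fun z => max (bump p ρ z) (h z)) := by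
    simpa using (lipschitzWith_bump p ρ).max hh
  have hp : h p = 0 := hball p (by simpa using hρ)
  have hs : |y (ofLipschitz x₀ _ hsup)| ≤ c := by
    refine hy _ _ ?_
    rw [hp, hq, bump_self p hρ.le, bump_eq_zero (hρ₂.trans_eq (dist_comm p q)), max_self,
      max_eq_left hρ.le, sub_zero]
    exact hρ₁
  have hadd (z : M) : max (bump p ρ z) (h z) = bump p ρ z + h z := by
    rcases lt_or_ge (dist z p) ρ with hz | hz
    · rw [hball z hz, max_eq_left (bump_nonneg p ρ z), add_zero]
    · rw [bump_eq_zero hz, max_eq_right (h0 z), zero_add]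
  have he : ofLipschitz x₀ h hh =
      ofLipschitz x₀ _ hsup - ofLipschitz x₀ _ (lipschitzWith_bump p ρ) := by
    rw [eq_sub_iff_add_eq]
    ext z
    simp only [add_apply, ofLipschitz_apply, hadd]
    ring
  rw [he, map_sub]
  exact (abs_sub _ _).trans (by linarith)

end SmallOnNorming

/-- A bound on the nonnegative functions that vanish wherever `f` does gives one on `f`, by splitting
`f` into its positive and negative parts. -/
theorem abs_apply_le_of_posPart {y : StrongDual ℝ (LipZero M x₀)} {K : NNReal} {C : ℝ}
    {f : M → ℝ} (hf : LipschitzWith K f)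
    (H : ∀ (g : M → ℝ) (hg : LipschitzWith K g), (∀ z, 0 ≤ g z) → (∀ z, f z = 0 → g z = 0) →
      |y (ofLipschitz x₀ g hg)| ≤ C) :
    |y (ofLipschitz x₀ f hf)| ≤ 2 * C := by
  have h₁ := H _ (hf.max_const 0) (fun z => le_max_right _ _) (fun z hz => by simp [hz])
  have h₂ := H _ (hf.neg.max_const 0) (fun z => le_max_right _ _) (fun z hz => by simp [hz])
  have he : ofLipschitz x₀ f hf =
      ofLipschitz x₀ _ (hf.max_const 0) - ofLipschitz x₀ _ (hf.neg.max_const 0) := by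
    rw [eq_sub_iff_add_eq]
    ext z
    have key (t : ℝ) : max t 0 = t + max (-t) 0 := by
      rcases le_total t 0 with h | h
      · rw [max_eq_right h, max_eq_left (by linarith)]; ring
      · rw [max_eq_left h, max_eq_right (by linarith)]; ring
    simp only [add_apply, ofLipschitz_apply, Pi.neg_apply]
    rw [key (f z), key (f x₀)]
    ring
  rw [he, map_sub]
  exact (abs_sub _ _).trans (by linarith)

/-! ### Finitely many molecules suffice -/

/-- At an isolated point `p` with a nearly closest point `q`, a single molecule suffices. -/
theorem SmallOnNorming.abs_apply_le_of_isolated {y : StrongDual ℝ (LipZero M x₀)} {p q : M}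
    {η c ρ : ℝ} (hy : SmallOnNorming y p q η c) (hη : η ≤ 1 / 2) (hρ : 0 < ρ)
    (hiso : ∀ z, z ≠ p → ρ ≤ dist z p) (hqp : q ≠ p) (hq : (1 - η) * dist p q ≤ ρ)
    {h : LipZero M x₀} (hh : ‖h‖ ≤ 1 / 4) : |y h| ≤ 8 * c := by
  have hρ₂ : ρ ≤ dist p q := (hiso q hqp).trans_eq (dist_comm q p)
  have hball (z : M) (hz : dist z p < ρ) : z = p := by
    by_contra hne
    exact absurd hz (hiso z hne).not_gt
  have hb := hy.apply_bump hρ.le hq hρ₂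
  have hc : 0 ≤ c := (abs_nonneg _).trans hb
  set t : ℝ := (h p - h q) / ρ with ht
  -- `d(p, q) ≤ 2 ρ` since `η ≤ 1 / 2`, and `h` is `1 / 4`-Lipschitz.
  have ht' : |t| ≤ 1 / 2 := by
    rw [ht, abs_div, abs_of_pos hρ, div_le_iff₀ hρ]
    have h₁ := h.abs_sub_le p q
    have h₂ : ‖h‖ * dist p q ≤ 1 / 4 * dist p q := mul_le_mul_of_nonneg_right hh dist_nonneg
    nlinarith [dist_nonneg (x := p) (y := q)]
  have hr : LipschitzWith 1 (fun z => h z - h q - t * bump p ρ z) := by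
    refine LipschitzWith.of_dist_le_mul fun z w => ?_
    have h₁ := h.abs_sub_le z w
    have h₂ : ‖h‖ * dist z w ≤ 1 / 4 * dist z w := mul_le_mul_of_nonneg_right hh dist_nonneg
    have h₃ : |bump p ρ z - bump p ρ w| ≤ dist z w := by
      simpa [Real.dist_eq] using (lipschitzWith_bump p ρ).dist_le_mul z w
    have h₄ : |t * (bump p ρ z - bump p ρ w)| ≤ 1 / 2 * dist z w := by
      rw [abs_mul]
      exact mul_le_mul ht' h₃ (abs_nonneg _) (by norm_num)
    have h₅ := abs_sub (h z - h w) (t * (bump p ρ z - bump p ρ w))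
    rw [Real.dist_eq, NNReal.coe_one, show h z - h q - t * bump p ρ z - (h w - h q - t * bump p ρ w)
      = h z - h w - t * (bump p ρ z - bump p ρ w) by ring]
    linarith [dist_nonneg (x := z) (y := w)]
  have hrest : |y (ofLipschitz x₀ _ hr)| ≤ 2 * (2 * c) := by
    refine abs_apply_le_of_posPart hr fun g hg hg0 hgz => ?_
    refine hy.apply_of_nonneg hρ hq hρ₂ hg hg0 (fun z hz => hgz z ?_) (hgz q ?_)
    · rw [hball z hz, bump_self p hρ.le, ht, div_mul_cancel₀ _ hρ.ne', sub_self]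
    · rw [bump_eq_zero (hiso q hqp)]; ring
  have he : h = t • ofLipschitz x₀ _ (lipschitzWith_bump p ρ) + ofLipschitz x₀ _ hr := by
    ext z
    simp only [add_apply, smul_apply, ofLipschitz_apply, apply_base]
    ring
  rw [he, map_add, map_smul, smul_eq_mul]
  refine (abs_add_le _ _).trans ?_
  rw [abs_mul]
  have := mul_le_mul ht' hb (abs_nonneg _) (by norm_num)
  linarith

/-- Two molecules suffice if their points `p, q` and `p', q'` are close in comparison with
`d(p, p')`. -/
theorem SmallOnNorming.abs_apply_le_of_separated {y : StrongDual ℝ (LipZero M x₀)}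
    {p q p' q' : M} {η c : ℝ} (hη : 0 ≤ η) (hy : SmallOnNorming y p q η c)
    (hy' : SmallOnNorming y p' q' η c) (hpq : p ≠ q) (hpq' : p' ≠ q')
    (hd : dist p q ≤ dist p p' / 4) (hd' : dist p' q' ≤ dist p p' / 4)
    {h : LipZero M x₀} (hh : ‖h‖ ≤ 1 / 4) : |y h| ≤ 8 * c := by
  have hR := dist_pos.2 hpq
  have hR' := dist_pos.2 hpq'
  have hη₁ : (1 - η) * dist p q ≤ dist p q := mul_le_of_le_one_left hR.le (by linarith)
  have hη₁' : (1 - η) * dist p' q' ≤ dist p' q' := mul_le_of_le_one_left hR'.le (by linarith)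
  have hf : LipschitzWith (1 / 4) (fun z => h z - h p) := by
    refine LipschitzWith.of_dist_le_mul fun z w => ?_
    have := (h.abs_sub_le z w).trans (mul_le_mul_of_nonneg_right hh dist_nonneg)
    simpa [Real.dist_eq] using this
  have he : h = ofLipschitz x₀ _ hf := by
    ext z
    simp
  rw [he, show 8 * c = 2 * (2 * c + 2 * c) by ring]
  refine abs_apply_le_of_posPart hf fun g hg hg0 hgz => ?_
  have hgp : g p = 0 := hgz p (sub_self _)
  have hgle (z : M) : g z ≤ dist z p / 4 := by
    have := (le_abs_self _).trans (hg.dist_le_mul z p)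
    rw [hgp, sub_zero] at this
    norm_num at this
    linarith
  -- The slope `1 / 2` of `b` lies above that of `g`, so that `g ⊓ b = g` near `p`, and is small enough
  -- for the remainder `g - g ⊓ b` to be `1`-Lipschitz.
  have hb : LipschitzWith (1 / 2) (fun z => bump p (2 * dist p q) z / 2) := by
    refine LipschitzWith.of_dist_le_mul fun z w => ?_
    have := (lipschitzWith_bump p (2 * dist p q)).dist_le_mul z w
    rw [Real.dist_eq, NNReal.coe_one, one_mul] at this
    rw [Real.dist_eq, ← sub_div, abs_div, abs_two]
    push_cast
    linarith
  have hu' := hg.min hb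
  have hv' := hg.sub hu'
  have hmax : max (1 / 4 : NNReal) (1 / 2) = 1 / 2 := max_eq_right (by
    rw [← NNReal.coe_le_coe]; norm_num)
  rw [hmax] at hu' hv'
  have hu : LipschitzWith 1 (fun z => min (g z) (bump p (2 * dist p q) z / 2)) :=
    hu'.weaken (by rw [← NNReal.coe_le_coe]; norm_num)
  have hv : LipschitzWith 1 (fun z => g z - min (g z) (bump p (2 * dist p q) z / 2)) :=
    hv'.weaken (by rw [← NNReal.coe_le_coe]; norm_num)
  have hvz (z : M) (hz : dist z p ≤ dist p q) :
      g z - min (g z) (bump p (2 * dist p q) z / 2) = 0 := by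
    rw [min_eq_left, sub_self]
    have : 2 * dist p q - dist z p ≤ bump p (2 * dist p q) z := le_max_left _ _
    linarith [hgle z]
  have huz (z : M) (hz : dist z p' ≤ dist p' q') :
      min (g z) (bump p (2 * dist p q) z / 2) = 0 := by
    have := dist_triangle_left p p' z
    rw [bump_eq_zero (by linarith), zero_div, min_eq_right (hg0 z)]
  have h₁ := hy'.apply_of_nonneg hR' hη₁' le_rfl hu
    (fun z => le_min (hg0 z) (div_nonneg (bump_nonneg _ _ _) zero_le_two)) (fun z hz => huz z hz.le)
    (huz q' (dist_comm q' p').le)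
  have h₂ := hy.apply_of_nonneg hR hη₁ le_rfl hv
    (fun z => sub_nonneg.2 (min_le_left _ _)) (fun z hz => hvz z hz.le)
    (hvz q (dist_comm q p).le)
  have hsplit : ofLipschitz x₀ g hg = ofLipschitz x₀ _ hu + ofLipschitz x₀ _ hv := by
    ext z
    simp only [add_apply, ofLipschitz_apply]
    ring
  rw [hsplit, map_add]
  exact (abs_add_le _ _).trans (add_le_add h₁ h₂)

/-- There are finitely many molecules such that a functional which is small on the functions nearly
norming them is small on the ball of radius `1 / 4` of `Lip₀(M)`. -/
theorem exists_finite_smallOnNorming [Nontrivial M] (x₀ : M) {η : ℝ} (hη : 0 < η)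
    (hη' : η ≤ 1 / 2) :
    ∃ A : Set (M × M), A.Finite ∧ (∀ a ∈ A, a.1 ≠ a.2) ∧
      ∀ (y : StrongDual ℝ (LipZero M x₀)) (c : ℝ), (∀ a ∈ A, SmallOnNorming y a.1 a.2 η c) →
        ∀ h : LipZero M x₀, ‖h‖ ≤ 1 / 4 → |y h| ≤ 8 * c := by
  by_cases hM : ∃ p : M, 0 < Metric.infDist p {p}ᶜ
  · obtain ⟨p, hp⟩ := hM
    have hlt : Metric.infDist p {p}ᶜ < Metric.infDist p {p}ᶜ / (1 - η) := by
      rw [lt_div_iff₀ (by linarith)]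
      nlinarith
    obtain ⟨q, hq, hpq⟩ := (Metric.infDist_lt_iff (exists_ne p)).1 hlt
    rw [lt_div_iff₀ (by linarith), mul_comm] at hpq
    refine ⟨{(p, q)}, Set.finite_singleton _, ?_, fun y c hy h hh => ?_⟩
    · rintro _ rfl
      exact Ne.symm hq
    · refine (hy _ rfl).abs_apply_le_of_isolated hη' hp (fun z hz => ?_) hq hpq.le hh
      rw [dist_comm]
      exact Metric.infDist_le_dist_of_mem hz
  · push Not at hM
    have hclose (p : M) {r : ℝ} (hr : 0 < r) : ∃ q, q ≠ p ∧ dist p q < r :=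
      (Metric.infDist_lt_iff (exists_ne p)).1 ((hM p).trans_lt hr)
    obtain ⟨p, p', hpp⟩ := exists_pair_ne M
    have hD : 0 < dist p p' / 4 := by
      have := dist_pos.2 hpp
      positivity
    obtain ⟨q, hq, hpq⟩ := hclose p hD
    obtain ⟨q', hq', hpq'⟩ := hclose p' hD
    refine ⟨{(p, q), (p', q')}, Set.toFinite _, ?_, fun y c hy h hh => ?_⟩
    · rintro _ (rfl | rfl)
      · exact hq.symm
      · exact hq'.symm
    · exact (hy (p, q) (by simp)).abs_apply_le_of_separated hη.le (hy (p', q') (by simp))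
        hq.symm hq'.symm hpq.le hpq'.le hh

end LipZero

open LipZero in
theorem not_isSAlmostSquare_lipschitzFree {M : Type*} [MetricSpace M] [Nontrivial M] (x₀ : M)
    {s : ℝ} (hs : 0 < s) (hs1 : s ≤ 1) : ¬ IsSAlmostSquare s (lipschitzFree M x₀) := by
  classical
  intro H
  obtain ⟨A, hA, hne, hsmall⟩ :=
    exists_finite_smallOnNorming x₀ (η := s / 128) (by positivity) (by linarith)
  let m : M × M → lipschitzFree M x₀ := fun a =>
    ⟨molecule x₀ a.1 a.2, molecule_mem_lipschitzFree a.1 a.2⟩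
  obtain ⟨y, hy, hyA⟩ := H (s / 128) (by positivity) (hA.toFinset.image m) (by
    intro x hx
    obtain ⟨a, ha, rfl⟩ := Finset.mem_image.1 hx
    exact norm_molecule (hne a (hA.mem_toFinset.1 ha)))
  -- Here `c = (ε + η) / s = 1 / 64`, so `|y h| ≤ 1 / 8` whenever `‖h‖ ≤ 1 / 4`, whence `‖y‖ ≤ 1 / 2`.
  have hball : ∀ h : LipZero M x₀, ‖h‖ ≤ 1 / 4 → |y.1 h| ≤ 1 / 8 := by
    intro h hh
    have := hsmall y.1 ((s / 128 + s / 128) / s) (fun a ha => by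
      obtain ⟨h₁, h₂⟩ := hyA (m a) (Finset.mem_image_of_mem m (hA.mem_toFinset.2 ha))
      exact abs_apply_le_of_norm_molecule_add_smul_le (hne a ha) hs h₁ h₂) h hh
    refine this.trans_eq ?_
    field_simp
    norm_num
  have hle : ‖y.1‖ ≤ 1 / 2 := by
    refine ContinuousLinearMap.opNorm_le_bound _ (by norm_num) fun h => ?_
    rcases eq_or_ne h 0 with rfl | h0
    · simp
    · have hn : 0 < ‖h‖ := norm_pos_iff.2 h0
      have := hball ((1 / 4 * ‖h‖⁻¹) • h) (by
        rw [norm_smul, Real.norm_eq_abs, abs_of_pos (by positivity), mul_assoc,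
          inv_mul_cancel₀ hn.ne', mul_one])
      rw [map_smul, smul_eq_mul, abs_mul, abs_of_pos (by positivity), mul_assoc] at this
      have h2 : ‖h‖⁻¹ * |y.1 h| ≤ 1 / 2 := by linarith
      rwa [inv_mul_le_iff₀ hn, mul_comm] at h2
  have hy1 : ‖y.1‖ = 1 := hy
  linarith

theorem theorem4p1 {M : Type*} [MetricSpace M] [Nontrivial M] (x₀ : M) :
    ¬ IsAlmostSquare (lipschitzFree M x₀) ∧
      ∀ s : ℝ, 0 < s → s ≤ 1 → ¬ IsSAlmostSquare s (lipschitzFree M x₀) := by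
  refine ⟨fun H => ?_, fun s hs hs1 => not_isSAlmostSquare_lipschitzFree x₀ hs hs1⟩
  refine not_isSAlmostSquare_lipschitzFree x₀ one_pos le_rfl fun ε hε A hA => ?_
  simpa only [one_smul] using H ε hε A hA
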